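/- Let $n>2k\ge 6$ be integers, and write $[a,b]=\{a,a+1,\ldots,b\}$, $[n]=[1,n]$. **Definitions.** For finite sets $A,B$ of positive integers write $A\prec B$ if $A\supseteq B$, or if $A\setminus B\neq\emptyset$ and every element of $B\setminus A$ is larger than $\min(A\setminus B)$; write $A<B$ if $A\prec B$ and $A\ne B$. This is a total order. For a set $S\subset[n]$ let $$\mathcal L(S,a):=\Big\{A\in\tbinom{[2,n]}{a}\ :\ A\prec S\cap[2,n]\Big\}.$$ Sets $S\subset[n]$ and $T\subset[2,n]$ *form a resistant pair* if either $T=\{2,3,4\}$ and $S=\{1,4\}$, or $T$ is non-empty and, with $j$ the largest element of $T$, 1. $S\cap T=\{j\}$, $S\cup T=[j]$, $|S|\le k$, $|T|\le k$; 2. $|[i]\cap S|<|[i]\setminus S|$ for each integer $i\ge 4$. Let $(S_1,T_1),\ldots,(S_m,T_m)$ be all the resistant pairs, and put $T_0:=[2,n]$ (so that $\mathcal L(T_0,k)=\emptyset$) and $S_0:=\{1,n\}$ (so that $\mathcal L(S_0,k-1)=\binom{[2,n]}{k-1}$). Let the pairs be numbered so that $T_0<T_1<T_2<\cdots<T_m$.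 Two families $\mathcal A,\mathcal B$ are *cross-intersecting* if $A\cap B\neq\emptyset$ for all $A\in\mathcal A$, $B\in\mathcal B$. The *diversity* of a family $\mathcal F\subset\binom{[n]}{k}$ is $\gamma(\mathcal F):=|\mathcal F|-\Delta(\mathcal F)$, where $\Delta(\mathcal F)$ is the largest number of members of $\mathcal F$ that contain a common element of $[n]$. **Theorem.** For each $l\in[m]$, $$|\mathcal L(S_{l-1},k-1)|+|\mathcal L(T_{l-1},k)|>|\mathcal L(S_l,k-1)|+|\mathcal L(T_l,k)|.$$ For each $l\in[m]$, any cross-intersecting families $\mathcal A\subset\binom{[2,n]}{k-1}$, $\mathcal B\subset\binom{[2,n]}{k}$ with $|\mathcal L(T_{l-1},k)|<|\mathcal B|\le|\mathcal L(T_l,k)|$ satisfy $$|\mathcal A|+|\mathcal B|\le|\mathcal L(S_l,k-1)|+|\mathcal L(T_l,k)|.$$ For each $l\in[m]$, any intersecting family $\mathcal F\subset\binom{[n]}{k}$ with $|\mathcal L(T_{l-1},k)|<\gamma(\mathcal F)\le|\mathcal L(T_l,k)|$ satisfies $$|\mathcal F|\le|\mathcal L(S_l,k-1)|+|\mathcal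 L(T_l,k)|.$$ -/

import Mathlib

/-- The lexicographical/containment order: `A ≼ B` iff `A ⊇ B`, or the minimal element of `A \ B`
exists and is smaller than the minimal element of `B \ A`. -/
def LexLE (A B : Finset ℕ) : Prop :=
  B ⊆ A ∨ ∃ x ∈ A \ B, ∀ y ∈ B \ A, x < y

/-- The strict version of `LexLE`. -/
def LexLT (A B : Finset ℕ) : Prop :=
  LexLE A B ∧ A ≠ B

open Classical in
/-- The family `𝓛(X, S, a)` of all `a`-element subsets `A` of `X` with `A ≼ S ∩ X`. -/
noncomputable def lexFamily (X S : Finset ℕ) (a : ℕ) : Finset (Finset ℕ) :=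
  (X.powersetCard a).filter (fun A => LexLE A (S ∩ X))

/-- The family `𝓛([2,n], S, a)`. -/
noncomputable def lexFam (n : ℕ) (S : Finset ℕ) (a : ℕ) : Finset (Finset ℕ) :=
  lexFamily (Finset.Icc 2 n) S a

/-- `S ⊆ [n]` and `T ⊆ [2,n]` form a resistant pair (with respect to `n` and `k`). -/
def IsResistantPair (n k : ℕ) (S T : Finset ℕ) : Prop :=
  S ⊆ Finset.Icc 1 n ∧ T ⊆ Finset.Icc 2 n ∧
    ((S = {1, 4} ∧ T = {2, 3, 4}) ∨
      ∃ j : ℕ, IsGreatest (T : Set ℕ) j ∧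
        S ∩ T = {j} ∧ S ∪ T = Finset.Icc 1 j ∧ S.card ≤ k ∧ T.card ≤ k ∧
        ∀ i : ℕ, 4 ≤ i → (Finset.Icc 1 i ∩ S).card < (Finset.Icc 1 i \ S).card)

/-- `(S 1, T 1), …, (S m, T m)` is the list of all resistant pairs, ordered so that
`T 0 < T 1 < … < T m` in the lexicographical order, where `S 0 = {1, n}` and `T 0 = [2, n]`.
Values at indices larger than `m` are irrelevant. -/
structure IsResistantEnumeration (n k m : ℕ) (S T : ℕ → Finset ℕ) : Prop where
  S_zero : S 0 = {1, n}
  T_zero : T 0 = Finset.Icc 2 n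
  resistant : ∀ l : ℕ, 1 ≤ l → l ≤ m → IsResistantPair n k (S l) (T l)
  exhaustive : ∀ S' T' : Finset ℕ, IsResistantPair n k S' T' →
    ∃ l : ℕ, 1 ≤ l ∧ l ≤ m ∧ S l = S' ∧ T l = T'
  increasing : ∀ l l' : ℕ, l < l' → l' ≤ m → LexLT (T l) (T l')

/-- Every member of `𝒜` meets every member of `ℬ`. -/
def CrossIntersecting (𝒜 ℬ : Finset (Finset ℕ)) : Prop :=
  ∀ A ∈ 𝒜, ∀ B ∈ ℬ, (A ∩ B).Nonempty

/-- The maximal degree `Δ(ℱ)` of a family on the ground set `[n]`. -/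
def maxDeg (n : ℕ) (ℱ : Finset (Finset ℕ)) : ℕ :=
  (Finset.Icc 1 n).sup (fun i => (ℱ.filter (fun F => i ∈ F)).card)

/-- The diversity `γ(ℱ) = |ℱ| - Δ(ℱ)`. The subtraction never truncates, since `Δ(ℱ) ≤ |ℱ|`. -/
def diversity (n : ℕ) (ℱ : Finset (Finset ℕ)) : ℕ :=
  ℱ.card - maxDeg n ℱ

section

open Finset

/-! An (n-k)-set containing a member of ℬ has a complement in [2,n] that has size k-1 and misses
this member. So |𝒜|+|ℬ| is at most C(n-1,k-1) plus the excess of |ℬ| over its upper shadow at level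
n-k. By Kruskal–Katona (`card_upperSets_lexFam_le`) it suffices to bound this excess for an initial
segment ℒ(K,k). For a resistant pair, duality makes the sum equal to C(n-1,k-1) + `gain n k T`, so
the theorem compares gains.

Gains are controlled by a walk with height 2|w ∩ [2,i]| - i at time i. The k-sets and (n-k)-sets
with trace w on [2,j] differ in number by C(n-j,k-|w|) - C(n-j,k+|w|-j). As 2k < n, this is
nonpositive at nonnegative height and zero at height zero. Resistant sets have positive height from
time 4 on and, except for {2,3,4}, end with an up-step from height at least 2. Comparing two of them
at their first difference shows that the gain strictly drops along the order
(`IsResistantSet.gain_lt_gain`).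

Conversely, if K contains {2,3,4}, its walk returns to zero. Inside the zero-height block, double
counting shows that the upper shadow is at least as large as the family, so the excess is at most
the gain of the prefix. Trimming this prefix (`PositiveWalk.exists_isResistantSet`) yields a
resistant set, not earlier than K, of at least that gain. Intersecting families reduce to this case
by splitting at an element of maximal degree. -/

/-! ### The order, decided at the first difference -/

theorem lexLE_iff {A B : Finset ℕ} :
    LexLE A B ↔ A = B ∨ ∃ i, i ∈ A ∧ i ∉ B ∧ ∀ y < i, y ∈ A ↔ y ∈ B := by
  constructor
  · intro h
    by_cases hAB : A = B
    · exact Or.inl hAB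
    right
    have hne : (A \ B).Nonempty := by
      rcases h with h | ⟨x, hx, -⟩
      · by_contra hc
        rw [not_nonempty_iff_eq_empty, sdiff_eq_empty_iff_subset] at hc
        exact hAB (hc.antisymm h)
      · exact ⟨x, hx⟩
    have hmin := min'_mem _ hne
    have hle := fun y hy => min'_le (A \ B) y hy
    set i := (A \ B).min' hne
    refine ⟨i, by grind, by grind, fun y hy => ⟨fun hyA => ?_, fun hyB => ?_⟩⟩
    · by_contra hyB
      have := hle y (by grind)
      omega
    · by_contra hyA
      rcases h with h | ⟨x, hx, hx'⟩
      · exact hyA (h hyB)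
      · have h1 := hx' y (by grind)
        have h2 := hle x hx
        omega
  · rintro (rfl | ⟨i, hA, hB, h⟩)
    · exact Or.inl subset_rfl
    · refine Or.inr ⟨i, by grind, fun y hy => ?_⟩
      by_contra hc
      rcases eq_or_lt_of_le (not_lt.1 hc) with rfl | h'
      · grind
      · have := h y h'
        grind

theorem LexLE.refl (A : Finset ℕ) : LexLE A A := Or.inl subset_rfl

theorem LexLE.trans {A B C : Finset ℕ} (h₁ : LexLE A B) (h₂ : LexLE B C) : LexLE A C := by
  rw [lexLE_iff] at *
  rcases h₁ with rfl | ⟨i, hi⟩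
  · exact h₂
  rcases h₂ with rfl | ⟨l, hl⟩
  · exact Or.inr ⟨i, hi⟩
  right
  rcases lt_trichotomy i l with h | rfl | h
  · exact ⟨i, by grind⟩
  · exact ⟨i, by grind⟩
  · exact ⟨l, by grind⟩

theorem lexLE_or_exists (A B : Finset ℕ) :
    LexLE A B ∨ ∃ i, i ∈ B ∧ i ∉ A ∧ ∀ y < i, y ∈ B ↔ y ∈ A := by
  by_cases hAB : A = B
  · exact Or.inl (hAB ▸ LexLE.refl _)
  have hne : (symmDiff A B).Nonempty := by
    rw [nonempty_iff_ne_empty]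
    simpa using hAB
  have hmin := min'_mem _ hne
  have hle := fun y hy => min'_le (symmDiff A B) y hy
  set i := (symmDiff A B).min' hne
  have hag : ∀ y < i, (y ∈ A ↔ y ∈ B) := by
    intro y hy
    by_contra hc
    have := hle y (by rw [mem_symmDiff]; tauto)
    omega
  rw [mem_symmDiff] at hmin
  rcases hmin with h | h
  · exact Or.inl (lexLE_iff.2 (Or.inr ⟨i, h.1, h.2, hag⟩))
  · exact Or.inr ⟨i, h.1, h.2, fun y hy => (hag y hy).symm⟩

theorem LexLE.total (A B : Finset ℕ) : LexLE A B ∨ LexLE B A :=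
  (lexLE_or_exists A B).imp_right fun h => lexLE_iff.2 (Or.inr h)

theorem not_lexLE_iff {A B : Finset ℕ} :
    ¬ LexLE A B ↔ ∃ i, i ∈ B ∧ i ∉ A ∧ ∀ y < i, y ∈ B ↔ y ∈ A := by
  refine ⟨fun h => (lexLE_or_exists A B).resolve_left h, ?_⟩
  rintro ⟨i, hi⟩ h
  rcases lexLE_iff.1 h with rfl | ⟨l, hl⟩
  · grind
  · rcases lt_trichotomy i l with h | rfl | h <;> grind

theorem LexLE.antisymm {A B : Finset ℕ} (h₁ : LexLE A B) (h₂ : LexLE B A) : A = B := by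
  by_contra hne
  exact not_lexLE_iff.2 ((lexLE_iff.1 h₁).resolve_left hne) h₂

/-! ### Initial segments and blocks of prescribed trace -/

theorem mem_lexFam {n a : ℕ} {w A : Finset ℕ} (hw : w ⊆ Icc 2 n) :
    A ∈ lexFam n w a ↔ (A ⊆ Icc 2 n ∧ #A = a) ∧ LexLE A w := by
  classical
  simp only [lexFam, lexFamily, inter_eq_left.2 hw, mem_filter, mem_powersetCard]

/-- The `a`-subsets of `[2, n]` whose trace on `[2, j]` is `w`. -/
def block (n a j : ℕ) (w : Finset ℕ) : Finset (Finset ℕ) :=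
  ((Icc 2 n).powersetCard a).filter (fun B => B ∩ Icc 2 j = w)

theorem mem_block {n a j : ℕ} {w B : Finset ℕ} :
    B ∈ block n a j w ↔ (B ⊆ Icc 2 n ∧ #B = a) ∧ B ∩ Icc 2 j = w := by
  rw [block, mem_filter, mem_powersetCard]

theorem lexLE_iff_insert_or {j : ℕ} {w A : Finset ℕ} (hj : 1 ≤ j) (hw : w ⊆ Icc 2 j)
    (hA : ∀ x ∈ A, 2 ≤ x) :
    LexLE A w ↔ LexLE A (insert (j + 1) w) ∨ A ∩ Icc 2 (j + 1) = w := by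
  have hw' : ∀ x ∈ w, 2 ≤ x ∧ x ≤ j := fun x hx => mem_Icc.1 (hw hx)
  constructor
  · intro h
    rcases lexLE_iff.1 h with rfl | ⟨i, hiA, hiw, hi⟩
    · right; ext x; grind
    · rcases lt_trichotomy i (j + 1) with h' | rfl | h'
      · left
        rw [lexLE_iff]
        right
        exact ⟨i, hiA, by grind, fun y hy => by grind⟩
      · left; left
        intro x hx
        grind
      · right
        ext x
        grind
  · rintro (h | h)
    · exact h.trans (Or.inl (subset_insert _ _))
    · left
      rw [← h]; exact inter_subset_left

theorem not_lexLE_insert_of_inter_eq {j : ℕ} {w A : Finset ℕ} (hw : w ⊆ Icc 2 j)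
    (hA : ∀ x ∈ A, 2 ≤ x) (h : A ∩ Icc 2 (j + 1) = w) : ¬ LexLE A (insert (j + 1) w) := by
  have hjw : j + 1 ∉ w := fun h => by have := hw h; simp at this
  rw [not_lexLE_iff]
  have h' : ∀ x, x ∈ A ∩ Icc 2 (j + 1) ↔ x ∈ w := fun x => by rw [h]
  have hw' : ∀ x ∈ w, 2 ≤ x ∧ x ≤ j := fun x hx => mem_Icc.1 (hw hx)
  refine ⟨j + 1, mem_insert_self _ _, fun hjA => ?_, fun y hy => ?_⟩
  · have := h' (j + 1)
    have := hA _ hjA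
    grind
  · have := h' y
    grind

/-- Appending j+1 moves w earlier in the order; the sets passed over are exactly those with trace w
on [2,j+1]. -/
theorem card_lexFam_eq {n a j : ℕ} {w : Finset ℕ} (hj : 1 ≤ j) (hjn : j + 1 ≤ n)
    (hw : w ⊆ Icc 2 j) :
    #(lexFam n w a) = #(lexFam n (insert (j + 1) w) a) + #(block n a (j + 1) w) := by
  have hwn : w ⊆ Icc 2 n := hw.trans (Icc_subset_Icc_right (by omega))
  have hwn' : insert (j + 1) w ⊆ Icc 2 n := insert_subset (by simp; omega) hwn
  rw [← card_union_of_disjoint]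
  · congr 1
    ext A
    rw [mem_union, mem_lexFam hwn, mem_lexFam hwn', mem_block, ← and_or_left]
    refine and_congr_right fun hA => lexLE_iff_insert_or hj hw fun x hx => ?_
    exact (mem_Icc.1 (hA.1 hx)).1
  · rw [disjoint_left]
    intro A h1 h2
    rw [mem_lexFam hwn'] at h1
    rw [mem_block] at h2
    exact not_lexLE_insert_of_inter_eq hw (fun x hx => (mem_Icc.1 (h1.1.1 hx)).1) h2.2 h1.2

theorem card_block_eq {n a j : ℕ} {w : Finset ℕ} (hj : 1 ≤ j)
    (hw : w ⊆ Icc 2 j) :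
    #(block n a j w) = #(block n a (j + 1) w) + #(block n a (j + 1) (insert (j + 1) w)) := by
  have hw' : ∀ x ∈ w, 2 ≤ x ∧ x ≤ j := fun x hx => mem_Icc.1 (hw hx)
  rw [← card_union_of_disjoint]
  · congr 1
    ext A
    rw [mem_union, mem_block, mem_block, mem_block, ← and_or_left]
    refine and_congr_right fun hA => ?_
    simp only [Finset.ext_iff, mem_inter, mem_Icc, mem_insert]
    constructor
    · intro h
      by_cases hjA : j + 1 ∈ A
      · right; intro x; specialize h x; grind
      · left; intro x; specialize h x; grind
    · rintro (h | h) <;> intro x <;> specialize h x <;> grind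
  · rw [disjoint_left]
    intro A h1 h2
    rw [mem_block] at h1 h2
    have := h1.2.symm.trans h2.2
    have h3 : j + 1 ∈ w := this ▸ mem_insert_self _ _
    have := hw' _ h3
    omega

theorem card_block {n a j : ℕ} {w : Finset ℕ} (hj : 1 ≤ j) (hjn : j ≤ n) (hw : w ⊆ Icc 2 j)
    (ha : #w ≤ a) : #(block n a j w) = (n - j).choose (a - #w) := by
  have hw' : ∀ x ∈ w, 2 ≤ x ∧ x ≤ j := fun x hx => mem_Icc.1 (hw hx)
  have : n - j = #(Icc (j + 1) n) := by simp
  rw [this, ← card_powersetCard]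
  refine card_bij' (fun B _ => B \ w) (fun C _ => C ∪ w) ?_ ?_ ?_ ?_
  · intro B hB
    rw [mem_block] at hB
    have hwB : w ⊆ B := hB.2 ▸ inter_subset_left
    rw [mem_powersetCard, card_sdiff_of_subset hwB, hB.1.2]
    refine ⟨fun x hx => ?_, rfl⟩
    have h2 := mem_Icc.1 (hB.1.1 (mem_sdiff.1 hx).1)
    rw [← hB.2] at hx
    grind
  · intro C hC
    rw [mem_powersetCard] at hC
    have hC' : ∀ x ∈ C, j + 1 ≤ x ∧ x ≤ n := fun x hx => mem_Icc.1 (hC.1 hx)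
    rw [mem_block, card_union_of_disjoint, hC.2]
    · refine ⟨⟨fun x hx => ?_, by omega⟩, ?_⟩
      · rw [mem_Icc]; grind
      · ext x; grind
    · rw [disjoint_left]; grind
  · intro B hB
    rw [mem_block] at hB
    have hwB : w ⊆ B := hB.2 ▸ inter_subset_left
    exact sdiff_union_of_subset hwB
  · intro C hC
    rw [mem_powersetCard] at hC
    have hC' : ∀ x ∈ C, j + 1 ≤ x ∧ x ≤ n := fun x hx => mem_Icc.1 (hC.1 hx)
    ext x; grind

theorem block_eq_empty {n a j : ℕ} {w : Finset ℕ} (ha : a < #w) : block n a j w = ∅ := by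
  refine eq_empty_of_forall_notMem fun B hB => ?_
  rw [mem_block] at hB
  have := card_le_card (hB.2 ▸ inter_subset_left : w ⊆ B)
  omega

/-! ### Signs of block gains -/

/-- The hypotheses say that z is at least as close to M/2 as x is. -/
theorem choose_le_choose_of_add_le {x z M : ℕ} (hxz : x ≤ z) (h : x + z ≤ M) :
    M.choose x ≤ M.choose z := by
  have key : ∀ y, x ≤ y → 2 * y ≤ M → M.choose x ≤ M.choose y := by
    intro y hy
    induction y, hy using Nat.le_induction with
    | base => exact fun _ => le_rfl
    | succ y _ ih =>
      exact fun h => (ih (by omega)).trans (Nat.choose_le_succ_of_lt_half_left (by omega))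
  rcases le_total (2 * z) M with hz | hz
  · exact key z hxz hz
  · rw [← Nat.choose_symm (by omega : z ≤ M)]
    exact key _ (by omega) (by omega)

theorem choose_lt_choose_of_add_lt {x z M : ℕ} (hxz : x < z) (h : x + z < M) :
    M.choose x < M.choose z := by
  refine lt_of_lt_of_le ?_ (choose_le_choose_of_add_le (by omega : x + 1 ≤ z) (by omega))
  have h₁ := Nat.choose_succ_right_eq M x
  have h₂ : 0 < M.choose x := Nat.choose_pos (by omega)
  have h₃ : M.choose x * (x + 1) < M.choose x * (M - x) :=
    Nat.mul_lt_mul_of_pos_left (by omega) h₂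
  rw [← h₁] at h₃
  exact Nat.lt_of_mul_lt_mul_right h₃

/-- The excess of the `k`-sets over the `(n - k)`-sets of `[2, n]` that precede `w`. -/
noncomputable def gain (n k : ℕ) (w : Finset ℕ) : ℤ :=
  #(lexFam n w k) - #(lexFam n w (n - k))

/-- The excess of the `k`-sets over the `(n - k)`-sets of `[2, n]` whose trace on `[2, j]`
is `w`. -/
def blockGain (n k j : ℕ) (w : Finset ℕ) : ℤ :=
  #(block n k j w) - #(block n (n - k) j w)

theorem gain_eq_gain_insert_add {n k j : ℕ} {w : Finset ℕ} (hj : 1 ≤ j) (hjn : j + 1 ≤ n)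
    (hw : w ⊆ Icc 2 j) :
    gain n k w = gain n k (insert (j + 1) w) + blockGain n k (j + 1) w := by
  have h₁ := card_lexFam_eq (a := k) hj hjn hw
  have h₂ := card_lexFam_eq (a := n - k) hj hjn hw
  rw [gain, gain, blockGain, h₁, h₂]
  push_cast
  ring

theorem blockGain_eq_add {n k j : ℕ} {w : Finset ℕ} (hj : 1 ≤ j) (hw : w ⊆ Icc 2 j) :
    blockGain n k j w =
      blockGain n k (j + 1) w + blockGain n k (j + 1) (insert (j + 1) w) := by
  rw [blockGain, blockGain, blockGain, card_block_eq (a := k) hj hw,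
    card_block_eq (a := n - k) hj hw]
  push_cast
  ring

/-- After reflecting the second binomial, the lower indices are k-|w| and k+|w|-j. Their sum 2k-j is
below n-j, and their difference is the height. -/
theorem blockGain_nonpos {n k j : ℕ} {w : Finset ℕ} (hn : 2 * k < n) (hj : 1 ≤ j) (hjn : j ≤ n)
    (hw : w ⊆ Icc 2 j) (h : j ≤ 2 * #w) : blockGain n k j w ≤ 0 := by
  rw [blockGain]
  rcases lt_or_ge k (#w) with hk | hk
  · rw [block_eq_empty hk]
    simp
  rcases lt_or_ge (k + #w) j with hkj | hkj
  · omega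
  rw [card_block hj hjn hw hk, card_block hj hjn hw (by omega),
    ← Nat.choose_symm (by omega : n - k - #w ≤ n - j), sub_nonpos, Nat.cast_le]
  exact choose_le_choose_of_add_le (by omega) (by omega)

theorem blockGain_neg {n k j : ℕ} {w : Finset ℕ} (hn : 2 * k < n) (hj : 1 ≤ j) (hjn : j ≤ n)
    (hw : w ⊆ Icc 2 j) (hwk : #w ≤ k) (hkj : j ≤ k + #w) (h : j < 2 * #w) :
    blockGain n k j w < 0 := by
  rw [blockGain, card_block hj hjn hw hwk, card_block hj hjn hw (by omega),
    ← Nat.choose_symm (by omega : n - k - #w ≤ n - j), sub_neg, Nat.cast_lt]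
  exact choose_lt_choose_of_add_lt (by omega) (by omega)

theorem blockGain_eq_zero {n k j : ℕ} {w : Finset ℕ} (hn : 2 * k < n) (hj : 1 ≤ j) (hjn : j ≤ n)
    (hw : w ⊆ Icc 2 j) (hwk : #w ≤ k) (h : j = 2 * #w) : blockGain n k j w = 0 := by
  rw [blockGain, card_block hj hjn hw hwk, card_block hj hjn hw (by omega),
    ← Nat.choose_symm (by omega : n - k - #w ≤ n - j), sub_eq_zero, Nat.cast_inj]
  congr 1
  omega

/-! ### Gain along positive walks -/

/-- Reading membership of `2, …, j` as up-steps and non-membership as down-steps from height `-1`,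
the walk of `w` is positive at every time from `4` on. -/
def PositiveWalk (j : ℕ) (w : Finset ℕ) : Prop :=
  ∀ i, 4 ≤ i → i ≤ j → i < 2 * #(w ∩ Icc 2 i)

theorem PositiveWalk.mono {i j : ℕ} {w : Finset ℕ} (h : PositiveWalk j w) (hij : i ≤ j) :
    PositiveWalk i w := fun l hl hli => h l hl (hli.trans hij)

theorem inter_Icc_succ_of_mem {j : ℕ} {w : Finset ℕ} (hj : 1 ≤ j) (h : j + 1 ∈ w) :
    w ∩ Icc 2 (j + 1) = insert (j + 1) (w ∩ Icc 2 j) := by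
  ext x; grind

theorem inter_Icc_succ_of_notMem {j : ℕ} {w : Finset ℕ} (h : j + 1 ∉ w) :
    w ∩ Icc 2 (j + 1) = w ∩ Icc 2 j := by
  ext x; grind

theorem card_inter_Icc_succ_of_mem {j : ℕ} {w : Finset ℕ} (hj : 1 ≤ j) (h : j + 1 ∈ w) :
    #(w ∩ Icc 2 (j + 1)) = #(w ∩ Icc 2 j) + 1 := by
  rw [inter_Icc_succ_of_mem hj h, card_insert_of_notMem (by simp)]

/-- Along a positive walk the gain of the prefixes increases. -/
theorem gain_inter_le_gain_inter {n k i j : ℕ} {w : Finset ℕ} (hn : 2 * k < n) (hi : 4 ≤ i)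
    (hij : i ≤ j) (hjn : j ≤ n) (h : PositiveWalk j w) :
    gain n k (w ∩ Icc 2 i) ≤ gain n k (w ∩ Icc 2 j) := by
  induction j, hij using Nat.le_induction with
  | base => exact le_rfl
  | succ j hij ih =>
    refine (ih (by omega) (h.mono (by omega))).trans ?_
    by_cases hjw : j + 1 ∈ w
    · rw [inter_Icc_succ_of_mem (by omega) hjw,
        gain_eq_gain_insert_add (by omega) hjn inter_subset_right]
      have h₁ := h j (by omega) (by omega)
      -- From height at least 1, skipping j+1 leaves height at least 0, so removing that block
      -- cannot lower the gain.
      have := blockGain_nonpos (j := j + 1) (w := w ∩ Icc 2 j) hn (by omega) hjn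
        (inter_subset_right.trans (Icc_subset_Icc_right (by omega))) (by omega)
      omega
    · rw [inter_Icc_succ_of_notMem hjw]

/-- Along a positive walk the gain strictly before the prefixes decreases. -/
theorem gain_sub_blockGain_inter_le {n k i j : ℕ} {w : Finset ℕ} (hn : 2 * k < n) (hi : 4 ≤ i)
    (hij : i ≤ j) (hjn : j ≤ n) (h : PositiveWalk j w) :
    gain n k (w ∩ Icc 2 j) - blockGain n k j (w ∩ Icc 2 j) ≤
      gain n k (w ∩ Icc 2 i) - blockGain n k i (w ∩ Icc 2 i) := by
  induction j, hij using Nat.le_induction with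
  | base => exact le_rfl
  | succ j hij ih =>
    refine le_trans ?_ (ih (by omega) (h.mono (by omega)))
    have hsub : w ∩ Icc 2 j ⊆ Icc 2 j := inter_subset_right
    have hb := blockGain_eq_add (n := n) (k := k) (by omega : 1 ≤ j) hsub
    -- An up-step leaves the part strictly before the block unchanged; a down-step adds to it the
    -- sibling block containing j+1, which has positive height.
    by_cases hjw : j + 1 ∈ w
    · have := gain_eq_gain_insert_add (k := k) (by omega) hjn hsub
      rw [inter_Icc_succ_of_mem (by omega) hjw]
      omega
    · rw [inter_Icc_succ_of_notMem hjw]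
      have h₁ := h j (by omega) (by omega)
      have := blockGain_nonpos (j := j + 1) (w := insert (j + 1) (w ∩ Icc 2 j)) hn (by omega) hjn
        (insert_subset (by simp; omega) (hsub.trans (Icc_subset_Icc_right (by omega)))) (by
          rw [card_insert_of_notMem (by simp)]
          omega)
      omega

/-- Only supersets of {2,3,4} precede it within [2,n], so the gain strictly before its block starts
at 0. -/
theorem gain_base {n k : ℕ} (hn : 4 ≤ n) : gain n k {2, 3, 4} = blockGain n k 4 {2, 3, 4} := by
  have hsub : ({2, 3, 4} : Finset ℕ) ⊆ Icc 2 n := by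
    intro x hx
    simp at hx
    simp
    omega
  have key : ∀ a, lexFam n {2, 3, 4} a = block n a 4 {2, 3, 4} := by
    intro a
    ext A
    rw [mem_lexFam hsub, mem_block]
    refine and_congr_right fun hA => ?_
    constructor
    · intro h
      have h' : ({2, 3, 4} : Finset ℕ) ⊆ A := by
        rcases lexLE_iff.1 h with rfl | ⟨i, hiA, hiw, hi⟩
        · rfl
        · have := mem_Icc.1 (hA.1 hiA)
          have h4 : 4 < i := by grind
          intro x hx
          grind
      ext x; grind
    · intro h
      left
      rw [← h]; exact inter_subset_left
  rw [gain, blockGain, key, key]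

/-! ### Resistant sets and strict monotonicity of their gain -/

/-- `T` is the second member of a resistant pair, with largest element `j`. -/
structure IsResistantSet (n k j : ℕ) (T : Finset ℕ) : Prop where
  four_le : 4 ≤ j
  le : j ≤ n
  subset : T ⊆ Icc 2 j
  mem : j ∈ T
  base : T ∩ Icc 2 4 = {2, 3, 4}
  card_le : #T ≤ k
  walk : PositiveWalk j T
  last : j = 4 ∨ j + 2 < 2 * #T

theorem IsResistantSet.subset_Icc {n k j : ℕ} {T : Finset ℕ} (h : IsResistantSet n k j T) :
    T ⊆ Icc 2 n := h.subset.trans (Icc_subset_Icc_right h.le)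

theorem IsResistantSet.inter_self {n k j : ℕ} {T : Finset ℕ} (h : IsResistantSet n k j T) :
    T ∩ Icc 2 j = T := inter_eq_left.2 h.subset

theorem IsResistantSet.gain_lt {n k j : ℕ} {T : Finset ℕ} (hn : 2 * k < n)
    (h : IsResistantSet n k j T) :
    gain n k T < gain n k T - blockGain n k j T := by
  have h₁ := h.walk j h.four_le le_rfl
  have h₂ := h.card_le
  have h₃ := h.four_le
  have h₄ := h.le
  rw [h.inter_self] at h₁
  have := blockGain_neg hn (by omega) h.le h.subset h.card_le (by omega) h₁
  omega

theorem IsResistantSet.gain_neg {n k j : ℕ} {T : Finset ℕ} (hn : 2 * k < n)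
    (h : IsResistantSet n k j T) : gain n k T < 0 := by
  have h₁ := gain_sub_blockGain_inter_le hn le_rfl h.four_le h.le h.walk
  have h₂ := h.gain_lt hn
  rw [h.inter_self, h.base, gain_base (h.four_le.trans h.le)] at h₁
  omega

/-- At the first difference i, the sets preceding T ∩ [2,i] are those strictly before the block of
T' ∩ [2,i]. From this common value the gain rises along T, while the gain strictly before the block
falls along T'. -/
theorem IsResistantSet.gain_lt_gain {n k j j' : ℕ} {T T' : Finset ℕ} (hn : 2 * k < n)
    (h : IsResistantSet n k j T) (h' : IsResistantSet n k j' T') (hlt : LexLT T T') :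
    gain n k T' < gain n k T := by
  obtain ⟨i, hiT, hiT', hag⟩ := (lexLE_iff.1 hlt.1).resolve_left hlt.2
  have hij := mem_Icc.1 (h.subset hiT)
  have hi5 : 5 ≤ i := by
    by_contra hc
    have h1 : i ∈ T ∩ Icc 2 4 := by grind
    rw [h.base, ← h'.base] at h1
    grind
  obtain ⟨i, rfl⟩ : ∃ l, i = l + 1 := ⟨i - 1, by omega⟩
  have hp : T ∩ Icc 2 i = T' ∩ Icc 2 i := by
    ext x
    have := hag x
    grind
  have hjn := h.le
  have hj4 := h.four_le
  have hj4' := h'.four_le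
  rcases lt_or_ge i j' with hij' | hij'
  · have h₁ := gain_inter_le_gain_inter (i := i + 1) hn (by omega) hij.2 h.le h.walk
    rw [h.inter_self, inter_Icc_succ_of_mem (by omega) hiT, hp] at h₁
    have h₂ := gain_sub_blockGain_inter_le (i := i + 1) hn (by omega) hij' h'.le h'.walk
    rw [h'.inter_self, inter_Icc_succ_of_notMem hiT'] at h₂
    have h₃ := gain_eq_gain_insert_add (n := n) (k := k) (w := T' ∩ Icc 2 i) (by omega)
      (by omega : i + 1 ≤ n) inter_subset_right
    have h₄ := h'.gain_lt hn
    omega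
  -- Here T' is a proper prefix of T. Strictness comes from the last step of T: an up-step from
  -- height at least 2, which discards a block of positive height.
  · have hT' : T ∩ Icc 2 i = T' := by
      rw [hp, inter_eq_left]
      exact h'.subset.trans (Icc_subset_Icc_right hij')
    obtain ⟨j, rfl⟩ : ∃ l, j = l + 1 := ⟨j - 1, by omega⟩
    have h₁ := gain_inter_le_gain_inter (i := i) (j := j) hn (by omega) (by omega) (by omega)
      (h.walk.mono (by omega))
    have h₂ := gain_eq_gain_insert_add (n := n) (k := k) (w := T ∩ Icc 2 j) (by omega)
      h.le inter_subset_right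
    rw [← inter_Icc_succ_of_mem (by omega) h.mem, h.inter_self] at h₂
    have h₃ := card_inter_Icc_succ_of_mem (by omega) h.mem
    rw [h.inter_self] at h₃
    have h₄ := h.last
    have h₅ := h.card_le
    have h₆ := blockGain_neg (j := j + 1) (w := T ∩ Icc 2 j) hn (by omega) h.le
      (inter_subset_right.trans (Icc_subset_Icc_right (by omega))) (by omega) (by omega) (by omega)
    rw [hT'] at h₁
    omega

theorem inter_Icc_two_four {T : Finset ℕ} (h : 4 < 2 * #(T ∩ Icc 2 4)) :
    T ∩ Icc 2 4 = {2, 3, 4} := by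
  have h₁ : (Icc 2 4 : Finset ℕ) = {2, 3, 4} := by decide
  rw [h₁] at h ⊢
  refine eq_of_subset_of_card_le inter_subset_right ?_
  have : #({2, 3, 4} : Finset ℕ) = 3 := by decide
  omega

theorem isResistantSet_base {n k : ℕ} (hk : 3 ≤ k) (hn : 2 * k < n) :
    IsResistantSet n k 4 {2, 3, 4} where
  four_le := le_rfl
  le := by omega
  subset := by decide
  mem := by decide
  base := by decide
  card_le := hk
  walk i hi hi' := by
    obtain rfl : i = 4 := by omega
    decide
  last := Or.inl rfl

/-! ### Resistant pairs versus resistant sets -/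

theorem IsResistantPair.exists_isResistantSet {n k : ℕ} {S T : Finset ℕ} (hk : 3 ≤ k)
    (hn : 2 * k < n) (h : IsResistantPair n k S T) :
    ∃ j, IsResistantSet n k j T ∧ S ∩ Icc 2 n = insert j (Icc 2 j \ T) := by
  obtain ⟨hS, hT, ⟨rfl, rfl⟩ | ⟨j, hj, hinter, hunion, hSk, hTk, hwalk⟩⟩ := h
  · refine ⟨4, isResistantSet_base hk hn, ?_⟩
    ext x
    grind
  have hTj : ∀ x ∈ T, 2 ≤ x ∧ x ≤ j := fun x hx => ⟨(mem_Icc.1 (hT hx)).1, hj.2 hx⟩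
  have hjT : j ∈ T := hj.1
  have hjn := mem_Icc.1 (hT hjT)
  have hi : ∀ x, (x ∈ S ∧ x ∈ T) ↔ x = j := fun x => by
    rw [← mem_inter, hinter, mem_singleton]
  have hu : ∀ x, (x ∈ S ∨ x ∈ T) ↔ 1 ≤ x ∧ x ≤ j := fun x => by
    rw [← mem_union, hunion, mem_Icc]
  have hsum : ∀ i, #(Icc 1 i ∩ S) + #(Icc 1 i \ S) = i := fun i => by
    rw [card_inter_add_card_sdiff, Nat.card_Icc]
    omega
  have hlt : ∀ i < j, Icc 1 i \ S = T ∩ Icc 2 i := fun i hij => by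
    ext x
    have := hi x
    have := hu x
    have := hTj x
    grind
  have hTe : Icc 1 j \ S = T.erase j := by
    ext x
    have := hi x
    have := hu x
    have := hTj x
    grind
  have h1S : 1 ∈ S := by
    have := hTj 1
    have := hu 1
    grind
  have hjS : j ∈ S := ((hi j).2 rfl).1
  -- S contains 1 and j, so j ≤ 4 would violate the prefix condition at i = 4.
  have hj5 : 4 < j := by
    by_contra hc
    have h₁ := hwalk 4 le_rfl
    have h₂ := hsum 4
    have h₃ : ({1, j} : Finset ℕ) ⊆ Icc 1 4 ∩ S := by
      intro x
      grind
    have h₄ := card_le_card h₃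
    rw [card_pair (by omega)] at h₄
    omega
  have hpos : PositiveWalk j T := by
    intro i hi4 hij
    have h₁ := hwalk i hi4
    have h₂ := hsum i
    rcases eq_or_lt_of_le hij with rfl | hij
    · rw [hTe, card_erase_of_mem hjT] at h₁ h₂
      rw [inter_eq_left.2 fun x hx => mem_Icc.2 (hTj x hx)]
      omega
    · rw [hlt i hij] at h₁ h₂
      omega
  refine ⟨j, ⟨by omega, hjn.2, fun x hx => mem_Icc.2 (hTj x hx), hjT,
    inter_Icc_two_four (hpos 4 le_rfl hj5.le), hTk, hpos, Or.inr ?_⟩, ?_⟩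
  -- Since |S| = j+1-|T|, the prefix condition at i = j reads j+2 < 2|T|.
  · have h₁ := hwalk j (by omega)
    have h₂ := hsum j
    rw [hTe, card_erase_of_mem hjT] at h₁ h₂
    omega
  · ext x
    have := hi x
    have := hu x
    have := hTj x
    grind

/-- Outside the base case, S must be [1,j] without T \ {j}. The bound |S| ≤ k follows from `last`
and |T| ≤ k, and `last` also gives the prefix condition for i ≥ j. -/
theorem IsResistantSet.exists_isResistantPair {n k j : ℕ} {T : Finset ℕ}
    (h : IsResistantSet n k j T) : ∃ S, IsResistantPair n k S T := by
  have hj4 := h.four_le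
  have hjn := h.le
  have hTj : ∀ x ∈ T, 2 ≤ x ∧ x ≤ j := fun x hx => mem_Icc.1 (h.subset hx)
  have hjT := h.mem
  rcases h.last with rfl | hlast
  · have hT : T = {2, 3, 4} := by rw [← h.base, h.inter_self]
    subst hT
    refine ⟨{1, 4}, ?_, h.subset_Icc, Or.inl ⟨rfl, rfl⟩⟩
    intro x
    grind
  set S := Icc 1 j \ T.erase j with hS
  have hSmem : ∀ x, x ∈ S ↔ (1 ≤ x ∧ x ≤ j) ∧ (x ∈ T → x = j) := fun x => by
    rw [hS, mem_sdiff, mem_Icc, mem_erase]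
    tauto
  have hScard : #S + #T = j + 1 := by
    rw [hS, card_sdiff_of_subset, card_erase_of_mem hjT, Nat.card_Icc]
    · have h₁ := card_pos.2 ⟨j, hjT⟩
      have h₂ := card_le_card h.subset
      rw [Nat.card_Icc] at h₂
      omega
    · intro x
      have := hTj x
      grind
  have hsum : ∀ i, #(Icc 1 i ∩ S) + #(Icc 1 i \ S) = i := fun i => by
    rw [card_inter_add_card_sdiff, Nat.card_Icc]
    omega
  have hTk := h.card_le
  refine ⟨S, fun x => ?_, h.subset_Icc, Or.inr ⟨j, ⟨hjT, fun x hx => (hTj x hx).2⟩, ?_, ?_,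
    by omega, hTk, fun i hi => ?_⟩⟩
  · have := hSmem x
    grind
  · ext x
    have := hSmem x
    grind
  · ext x
    have := hSmem x
    have := hTj x
    grind
  · have h₂ := hsum i
    rcases lt_or_ge i j with hij | hij
    · have h₁ := h.walk i hi hij.le
      have h₃ : T ∩ Icc 2 i = Icc 1 i \ S := by
        ext x
        have := hSmem x
        have := hTj x
        grind
      rw [h₃] at h₁
      omega
    · have h₃ : Icc 1 i ∩ S = S := by
        refine inter_eq_right.2 fun x => ?_
        have := hSmem x
        grind
      rw [h₃] at h₂ ⊢
      omega

/-! ### Duality by complementation -/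

/-- Cross-intersecting duality: `[2, j] \ T ∪ {j}` precedes exactly the complements of the sets
that do not precede `T`. -/
theorem lexLE_insert_sdiff_iff {n j : ℕ} {T A : Finset ℕ} (hj : j ≤ n) (hT : T ⊆ Icc 2 j)
    (hjT : j ∈ T) (hA : A ⊆ Icc 2 n) :
    LexLE A (insert j (Icc 2 j \ T)) ↔ ¬ LexLE (Icc 2 n \ A) T := by
  have hT' : ∀ x ∈ T, 2 ≤ x ∧ x ≤ j := fun x hx => mem_Icc.1 (hT hx)
  have hA' : ∀ x ∈ A, 2 ≤ x ∧ x ≤ n := fun x hx => mem_Icc.1 (hA hx)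
  have hj2 := hT' j hjT
  rw [not_lexLE_iff]
  constructor
  · intro h
    rcases lexLE_iff.1 h with rfl | ⟨i, hi, hi', hag⟩
    · exact ⟨j, hjT, by grind, fun y hy => by grind⟩
    · rcases lt_or_ge i j with hij | hij
      · exact ⟨i, by grind, by grind, fun y hy => by have := hag y hy; grind⟩
      · refine ⟨j, hjT, ?_, fun y hy => ?_⟩
        · have := hag j
          grind
        · have := hag y
          grind
  · rintro ⟨i, hi, hi', hag⟩
    rcases lt_or_ge i j with hij | hij
    · refine lexLE_iff.2 (Or.inr ⟨i, by grind, by grind, fun y hy => ?_⟩)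
      have := hag y hy
      have := hT' i hi
      have := hA' y
      grind
    · left
      intro x hx
      have := hag x
      have := hT' i hi
      grind

/-- Complementation in [2,n] carries ℒ(T,n-k) onto the (k-1)-sets outside ℒ(S,k-1). -/
theorem card_lexFam_add_card_lexFam {n k j : ℕ} {S T : Finset ℕ} (hk : 1 ≤ k) (hn : 2 * k < n)
    (hj : j ≤ n) (hT : T ⊆ Icc 2 j) (hjT : j ∈ T) (hS : S ∩ Icc 2 n = insert j (Icc 2 j \ T)) :
    #(lexFam n S (k - 1)) + #(lexFam n T (n - k)) = (n - 1).choose (k - 1) := by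
  classical
  have hTn : T ⊆ Icc 2 n := hT.trans (Icc_subset_Icc_right hj)
  have hcard : #(Icc 2 n) = n - 1 := by simp
  rw [← hcard, ← card_powersetCard,
    ← card_filter_add_card_filter_not (s := (Icc 2 n).powersetCard (k - 1)) (fun A => ¬ LexLE (Icc 2 n \ A) T)]
  congr 1
  · rw [lexFam, lexFamily, hS]
    congr 1
    refine filter_congr fun A hA => ?_
    exact lexLE_insert_sdiff_iff hj hT hjT (mem_powersetCard.1 hA).1
  · refine card_bij' (fun A _ => Icc 2 n \ A) (fun A _ => Icc 2 n \ A) ?_ ?_ ?_ ?_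
    · intro A hA
      rw [mem_lexFam hTn] at hA
      rw [mem_filter, mem_powersetCard, card_sdiff_of_subset hA.1.1, hA.1.2, hcard,
        Finset.sdiff_sdiff_eq_self hA.1.1, not_not]
      exact ⟨⟨sdiff_subset, by omega⟩, hA.2⟩
    · intro A hA
      rw [mem_filter, mem_powersetCard, not_not] at hA
      rw [mem_lexFam hTn, card_sdiff_of_subset hA.1.1, hA.1.2, hcard]
      exact ⟨⟨sdiff_subset, by omega⟩, hA.2⟩
    · intro A hA
      rw [mem_lexFam hTn] at hA
      exact Finset.sdiff_sdiff_eq_self hA.1.1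
    · intro A hA
      rw [mem_filter, mem_powersetCard] at hA
      exact Finset.sdiff_sdiff_eq_self hA.1.1

theorem IsResistantSet.card_add_card {n k j : ℕ} {S T : Finset ℕ} (hk : 1 ≤ k) (hn : 2 * k < n)
    (h : IsResistantSet n k j T) (hS : S ∩ Icc 2 n = insert j (Icc 2 j \ T)) :
    ((#(lexFam n S (k - 1)) + #(lexFam n T k) : ℕ) : ℤ) =
      (n - 1).choose (k - 1) + gain n k T := by
  rw [gain, ← card_lexFam_add_card_lexFam hk hn h.le h.subset h.mem hS]
  push_cast
  ring

theorem lexFam_top {n k : ℕ} (hk : 3 ≤ k) (hn : 2 * k < n) : lexFam n (Icc 2 n) k = ∅ := by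
  refine eq_empty_of_forall_notMem fun A hA => ?_
  rw [mem_lexFam subset_rfl] at hA
  rcases lexLE_iff.1 hA.2 with rfl | ⟨i, hi, hi', -⟩
  · have := hA.1.2
    simp at this
    omega
  · exact hi' (hA.1.1 hi)

theorem card_lexFam_pair {n k : ℕ} (hk : 3 ≤ k) (hn : 2 * k < n) :
    #(lexFam n {1, n} (k - 1)) = (n - 1).choose (k - 1) := by
  classical
  have hcard : #(Icc 2 n) = n - 1 := by simp
  rw [← hcard, ← card_powersetCard, lexFam, lexFamily, filter_true_of_mem]
  intro A hA
  rw [mem_powersetCard] at hA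
  have h₁ : ({1, n} : Finset ℕ) ∩ Icc 2 n = {n} := by
    ext x
    grind
  rw [h₁, ← not_not (a := LexLE _ _), not_lexLE_iff]
  rintro ⟨i, hi, hi', hag⟩
  rw [mem_singleton] at hi
  subst hi
  obtain ⟨x, hx⟩ : A.Nonempty := card_pos.1 (by omega)
  have := mem_Icc.1 (hA.1 hx)
  have := hag x
  grind

/-! ### Trimming a positive prefix to a resistant set -/

/-- A positive prefix precedes some resistant set of at least the same gain. -/
theorem PositiveWalk.exists_isResistantSet {n k j : ℕ} {w : Finset ℕ} (hk : 3 ≤ k)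
    (hn : 2 * k < n) (hj : 4 ≤ j) (hjn : j ≤ n) (hw : #(w ∩ Icc 2 j) ≤ k) (h : PositiveWalk j w) :
    ∃ j' T, IsResistantSet n k j' T ∧ LexLE (w ∩ Icc 2 j) T ∧
      gain n k (w ∩ Icc 2 j) ≤ gain n k T := by
  induction j, hj using Nat.le_induction with
  | base =>
    rw [inter_Icc_two_four (h 4 le_rfl le_rfl)]
    exact ⟨4, _, isResistantSet_base hk hn, LexLE.refl _, le_rfl⟩
  | succ j hj ih =>
    have hpos := h.mono (Nat.le_succ j)
    by_cases hjw : j + 1 ∈ w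
    · have hc := card_inter_Icc_succ_of_mem (by omega) hjw
      specialize ih (by omega) (by omega) hpos
      have hj' := h j hj (by omega)
      -- An up-step from height at least 2 makes the prefix resistant. From height 1, the block
      -- skipped by the step has height 0 and gain 0, so dropping j+1 keeps the gain and moves the
      -- prefix later.
      rcases lt_or_ge (j + 1) (2 * #(w ∩ Icc 2 j)) with hlt | hge
      · refine ⟨j + 1, w ∩ Icc 2 (j + 1), ⟨by omega, hjn, inter_subset_right, by grind, ?_, hw, ?_,
          Or.inr (by omega)⟩, LexLE.refl _, le_rfl⟩
        · rw [← inter_Icc_two_four (h 4 le_rfl (by omega))]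
          ext x
          grind
        · intro i hi hij
          rw [inter_assoc, inter_eq_right.2 (Icc_subset_Icc_right hij)]
          exact h i hi hij
      · obtain ⟨j', T, hT, hle, hgain⟩ := ih
        rw [inter_Icc_succ_of_mem (by omega) hjw]
        have h₁ := gain_eq_gain_insert_add (n := n) (k := k) (w := w ∩ Icc 2 j) (by omega) hjn
          inter_subset_right
        rw [blockGain_eq_zero hn (by omega) hjn
          (inter_subset_right.trans (Icc_subset_Icc_right (by omega))) (by omega) (by omega)] at h₁
        exact ⟨j', T, hT, LexLE.trans (Or.inl (subset_insert _ _)) hle, by omega⟩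
    · rw [inter_Icc_succ_of_notMem hjw] at hw ⊢
      exact ih (by omega) hw hpos

/-! ### Kruskal–Katona, transported from colex to lex -/

/-- The complement of `B` in `[2, n]`, carried to `Fin (n - 1)` by the order-reversing map
`x ↦ n - x`. -/
def revCompl (n : ℕ) (B : Finset ℕ) : Finset (Fin (n - 1)) :=
  univ.filter fun i => n - (i : ℕ) ∉ B

theorem mem_revCompl {n : ℕ} {B : Finset ℕ} {i : Fin (n - 1)} :
    i ∈ revCompl n B ↔ n - (i : ℕ) ∉ B := by
  rw [revCompl, mem_filter, and_iff_right (mem_univ _)]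

theorem exists_fin_of_mem_Icc {n x : ℕ} (hx : x ∈ Icc 2 n) : ∃ i : Fin (n - 1), n - (i : ℕ) = x := by
  rw [mem_Icc] at hx
  exact ⟨⟨n - x, by omega⟩, by simp; omega⟩

theorem fin_sub_mem_Icc {n : ℕ} (i : Fin (n - 1)) : n - (i : ℕ) ∈ Icc 2 n := by
  have := i.2
  rw [mem_Icc]
  omega

theorem card_revCompl {n : ℕ} {B : Finset ℕ} (hB : B ⊆ Icc 2 n) :
    #(revCompl n B) = n - 1 - #B := by
  have h₁ : #(univ.filter fun i : Fin (n - 1) => n - (i : ℕ) ∈ B) = #B := by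
    refine card_bij (fun i _ => n - (i : ℕ)) (fun i hi => (mem_filter.1 hi).2) ?_ ?_
    · intro i _ l _ h
      have := i.2
      have := l.2
      ext
      omega
    · intro x hx
      obtain ⟨i, hi⟩ := exists_fin_of_mem_Icc (hB hx)
      exact ⟨i, by simp [hi, hx], hi⟩
  have h₂ := card_filter_add_card_filter_not (s := (univ : Finset (Fin (n - 1))))
    (fun i : Fin (n - 1) => n - (i : ℕ) ∈ B)
  rw [h₁, card_univ, Fintype.card_fin] at h₂
  rw [revCompl]
  omega

theorem revCompl_subset_revCompl {n : ℕ} {A B : Finset ℕ} (hA : A ⊆ Icc 2 n) :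
    revCompl n B ⊆ revCompl n A ↔ A ⊆ B := by
  constructor
  · intro h x hx
    obtain ⟨i, rfl⟩ := exists_fin_of_mem_Icc (hA hx)
    by_contra hxB
    exact mem_revCompl.1 (h (mem_revCompl.2 hxB)) hx
  · intro h i hi
    rw [mem_revCompl] at *
    exact fun hc => hi (h hc)

theorem revCompl_injOn (n : ℕ) : Set.InjOn (revCompl n) {B | B ⊆ Icc 2 n} := by
  intro A hA B hB h
  exact ((revCompl_subset_revCompl hA).1 h.ge).antisymm ((revCompl_subset_revCompl hB).1 h.le)

theorem exists_revCompl_eq {n : ℕ} (t : Finset (Fin (n - 1))) :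
    ∃ B ⊆ Icc 2 n, revCompl n B = t := by
  refine ⟨(univ.filter (· ∉ t)).image fun i : Fin (n - 1) => n - (i : ℕ), ?_, ?_⟩
  · intro x hx
    obtain ⟨i, -, rfl⟩ := mem_image.1 hx
    exact fin_sub_mem_Icc i
  · ext i
    rw [mem_revCompl, mem_image]
    constructor
    · intro h
      by_contra hi
      exact h ⟨i, by simp [hi], rfl⟩
    · rintro hi ⟨l, hl, hli⟩
      have : l = i := by
        have := i.2
        have := l.2
        ext
        omega
      subst this
      exact (mem_filter.1 hl).2 hi

/-- Colex is decided by the largest difference, which reversal turns into the smallest;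
complementing then puts the set owning that element first. -/
theorem toColex_revCompl_le {n : ℕ} {A B : Finset ℕ} (hA : A ⊆ Icc 2 n) (hB : B ⊆ Icc 2 n) :
    toColex (revCompl n A) ≤ toColex (revCompl n B) ↔ LexLE A B := by
  rw [Colex.toColex_le_toColex]
  simp only [mem_revCompl, not_not]
  constructor
  · intro h
    by_contra hc
    obtain ⟨i, hiB, hiA, hag⟩ := not_lexLE_iff.1 hc
    obtain ⟨a, rfl⟩ := exists_fin_of_mem_Icc (hB hiB)
    obtain ⟨b, hbB, hbA, hab⟩ := h hiA hiB
    have hab' : (a : ℕ) ≤ b := hab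
    rcases eq_or_lt_of_le hab' with heq | hlt
    · rw [heq] at hiB
      exact hbB hiB
    · exact hbB ((hag _ (by have := b.2; omega)).2 hbA)
  · intro h a haA haB
    rcases lexLE_iff.1 h with rfl | ⟨i, hiA, hiB, hag⟩
    · exact absurd haB haA
    obtain ⟨b, rfl⟩ := exists_fin_of_mem_Icc (hA hiA)
    refine ⟨b, hiB, hiA, ?_⟩
    by_contra hc
    have hc' : (b : ℕ) < a := not_le.1 hc
    exact haA ((hag _ (by have := a.2; omega)).2 haB)

/-- The `a`-subsets of `[2, n]` that contain a member of `ℱ`. -/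
def upperSets (n a : ℕ) (ℱ : Finset (Finset ℕ)) : Finset (Finset ℕ) :=
  ((Icc 2 n).powersetCard a).filter fun c => ∃ B ∈ ℱ, B ⊆ c

theorem mem_upperSets {n a : ℕ} {ℱ : Finset (Finset ℕ)} {c : Finset ℕ} :
    c ∈ upperSets n a ℱ ↔ (c ⊆ Icc 2 n ∧ #c = a) ∧ ∃ B ∈ ℱ, B ⊆ c := by
  rw [upperSets, mem_filter, mem_powersetCard]

-- Complements shrink from size n-1-k to k-1, hence n-2k shadow steps.
open FinsetFamily in
theorem image_revCompl_upperSets {n k : ℕ} (hk : 1 ≤ k) (hn : 2 * k < n)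
    {ℱ : Finset (Finset ℕ)} (hℱ : ℱ ⊆ (Icc 2 n).powersetCard k) :
    (upperSets n (n - k) ℱ).image (revCompl n) = ∂^[n - 2 * k] (ℱ.image (revCompl n)) := by
  ext t
  rw [mem_shadow_iterate_iff_exists_mem_card_add]
  constructor
  · intro h
    obtain ⟨c, hc, rfl⟩ := mem_image.1 h
    rw [mem_upperSets] at hc
    obtain ⟨⟨hc, hcn⟩, B, hB, hBc⟩ := hc
    have hB' := mem_powersetCard.1 (hℱ hB)
    refine ⟨_, mem_image_of_mem _ hB, (revCompl_subset_revCompl hB'.1).2 hBc, ?_⟩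
    rw [card_revCompl hB'.1, card_revCompl hc]
    omega
  · rintro ⟨s, hs, hts, hcard⟩
    obtain ⟨B, hB, rfl⟩ := mem_image.1 hs
    obtain ⟨c, hc, rfl⟩ := exists_revCompl_eq t
    have hB' := mem_powersetCard.1 (hℱ hB)
    rw [card_revCompl hB'.1, card_revCompl hc] at hcard
    have hc' := card_le_card hc
    rw [Nat.card_Icc] at hc'
    refine mem_image_of_mem _ (mem_upperSets.2 ⟨⟨hc, ?_⟩, B, hB,
      (revCompl_subset_revCompl hB'.1).1 hts⟩)
    omega

theorem card_image_revCompl {n a : ℕ} {ℱ : Finset (Finset ℕ)}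
    (hℱ : ℱ ⊆ (Icc 2 n).powersetCard a) : #(ℱ.image (revCompl n)) = #ℱ :=
  card_image_of_injOn ((revCompl_injOn n).mono fun _ hB => (mem_powersetCard.1 (hℱ hB)).1)

theorem lexFam_subset_powersetCard {n a : ℕ} {w : Finset ℕ} :
    lexFam n w a ⊆ (Icc 2 n).powersetCard a := by
  classical exact filter_subset _ _

/-- The Kruskal–Katona theorem for lexicographic initial segments and upper shadows. -/
theorem card_upperSets_lexFam_le {n k : ℕ} (hk : 1 ≤ k) (hn : 2 * k < n) {K : Finset ℕ}
    (hK : K ⊆ Icc 2 n) (hKk : #K = k) {ℬ : Finset (Finset ℕ)}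
    (hℬ : ℬ ⊆ (Icc 2 n).powersetCard k) (hle : #(lexFam n K k) ≤ #ℬ) :
    #(upperSets n (n - k) (lexFam n K k)) ≤ #(upperSets n (n - k) ℬ) := by
  have hup : ∀ ℱ, upperSets n (n - k) ℱ ⊆ (Icc 2 n).powersetCard (n - k) :=
    fun ℱ => filter_subset _ _
  have himg : (lexFam n K k).image (revCompl n) = Colex.initSeg (revCompl n K) := by
    ext t
    rw [Colex.mem_initSeg, mem_image]
    constructor
    · rintro ⟨A, hA, rfl⟩
      rw [mem_lexFam hK] at hA
      rw [card_revCompl hK, card_revCompl hA.1.1, toColex_revCompl_le hA.1.1 hK, hA.1.2, hKk]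
      exact ⟨rfl, hA.2⟩
    · rintro ⟨h₁, h₂⟩
      obtain ⟨A, hA, rfl⟩ := exists_revCompl_eq t
      rw [toColex_revCompl_le hA hK] at h₂
      rw [card_revCompl hK, card_revCompl hA] at h₁
      have h₃ := card_le_card hA
      have h₄ := card_le_card hK
      rw [Nat.card_Icc] at h₃ h₄
      exact ⟨A, (mem_lexFam hK).2 ⟨⟨hA, by omega⟩, h₂⟩, rfl⟩
  rw [← card_image_revCompl (hup _), ← card_image_revCompl (hup ℬ),
    image_revCompl_upperSets hk hn hℬ, image_revCompl_upperSets hk hn lexFam_subset_powersetCard,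
    himg]
  refine iterated_kk (r := n - 1 - k) ?_ ?_ ?_
  · intro t ht
    obtain ⟨B, hB, rfl⟩ := mem_image.1 (mem_coe.1 ht)
    have hB' := mem_powersetCard.1 (hℬ hB)
    rw [card_revCompl hB'.1, hB'.2]
  · rwa [← himg, card_image_revCompl lexFam_subset_powersetCard, card_image_revCompl hℬ]
  · have := Colex.isInitSeg_initSeg (s := revCompl n K)
    rwa [card_revCompl hK, hKk] at this

/-- The order is total, so appending the least missing k-set gives initial segments of every size.
-/
theorem exists_card_lexFam_eq {n k b : ℕ} (hb : 1 ≤ b) (hbn : b ≤ #((Icc 2 n).powersetCard k)) :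
    ∃ K ⊆ Icc 2 n, #K = k ∧ #(lexFam n K k) = b := by
  have step : ∀ ℱ ⊆ (Icc 2 n).powersetCard k, #ℱ < #((Icc 2 n).powersetCard k) →
      (∀ A ∈ (Icc 2 n).powersetCard k, ∀ B ∈ ℱ, LexLE A B → A ∈ ℱ) →
      ∃ K ⊆ Icc 2 n, #K = k ∧ #(lexFam n K k) = #ℱ + 1 := by
    intro ℱ hℱ hlt hdown
    obtain ⟨K, hK, hmin⟩ := exists_min_image ((Icc 2 n).powersetCard k \ ℱ)
      (fun A => toColex (revCompl n A)) (by
        rw [← card_pos, card_sdiff_of_subset hℱ]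
        omega)
    rw [mem_sdiff] at hK
    have hK' := mem_powersetCard.1 hK.1
    refine ⟨K, hK'.1, hK'.2, ?_⟩
    rw [← card_insert_of_notMem hK.2]
    congr 1
    ext A
    rw [mem_lexFam hK'.1, mem_insert, ← mem_powersetCard]
    constructor
    · rintro ⟨hA, hle⟩
      by_cases hAℱ : A ∈ ℱ
      · exact Or.inr hAℱ
      have := hmin A (mem_sdiff.2 ⟨hA, hAℱ⟩)
      rw [toColex_revCompl_le hK'.1 (mem_powersetCard.1 hA).1] at this
      exact Or.inl (hle.antisymm this)
    · rintro (rfl | hA)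
      · exact ⟨hK.1, LexLE.refl _⟩
      · refine ⟨hℱ hA, (LexLE.total A K).resolve_right fun h => hK.2 (hdown K hK.1 A hA h)⟩
  induction b, hb using Nat.le_induction with
  | base => exact step ∅ (empty_subset _) (by rw [card_empty]; omega) (by simp)
  | succ b hb ih =>
    obtain ⟨K, hK, hKk, hcard⟩ := ih (by omega)
    obtain ⟨K', h⟩ := step (lexFam n K k) lexFam_subset_powersetCard (by omega) (by
      intro A hA B hB hle
      rw [mem_lexFam hK] at *
      exact ⟨mem_powersetCard.1 hA, hle.trans hB.2⟩)
    rw [hcard] at h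
    exact ⟨K', h⟩

/-! ### Excess over the upper shadow, bounded at the first zero -/

/-- In a block of height zero, the upper shadow at complementary level does not shrink families. -/
theorem card_le_card_block_upperSets {n k j : ℕ} {w : Finset ℕ} (hn : 2 * k < n) (hj : 1 ≤ j)
    (hjn : j ≤ n) (hw : w ⊆ Icc 2 j) (hwk : #w ≤ k) (hjw : j = 2 * #w) {ℱ : Finset (Finset ℕ)}
    (hℱ : ℱ ⊆ block n k j w) :
    #ℱ ≤ #((block n (n - k) j w).filter fun c => ∃ B ∈ ℱ, B ⊆ c) := by
  have hw' : ∀ x ∈ w, 2 ≤ x ∧ x ≤ j := fun x hx => mem_Icc.1 (hw hx)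
  -- This degree serves both sides: adding n-2k new elements beyond j to B, and choosing the k-|w|
  -- elements of B \ w inside c \ w. The choices agree in number because j = 2|w|.
  have hpos : 0 < (n - k - #w).choose (k - #w) := Nat.choose_pos (by omega)
  refine Nat.le_of_mul_le_mul_right (card_mul_le_card_mul (fun B c => B ⊆ c) ?_ ?_) hpos
  · intro B hB
    have hB' := mem_block.1 (hℱ hB)
    have hwB : w ⊆ B := hB'.2 ▸ inter_subset_left
    have hBj : ∀ x ∈ B, x ≤ j → x ∈ w := fun x hx hxj => by
      rw [← hB'.2, mem_inter, mem_Icc]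
      exact ⟨hx, (mem_Icc.1 (hB'.1.1 hx)).1, hxj⟩
    have hY : #(Icc (j + 1) n \ B) = n - k - #w := by
      have h₁ : Icc (j + 1) n ∩ B = B \ w := by
        ext x
        have h₂ := hBj x
        have h₃ := hw' x
        have h₄ := @hB'.1.1 x
        grind
      have h₂ := card_sdiff_add_card_inter (Icc (j + 1) n) B
      rw [h₁, card_sdiff_of_subset hwB, hB'.1.2, Nat.card_Icc] at h₂
      omega
    have h₁ : n - k - #w - (n - 2 * k) = k - #w := by omega
    rw [← h₁, Nat.choose_symm (by omega), ← hY, ← card_powersetCard]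
    refine card_le_card_of_injOn (fun D => B ∪ D) ?_ ?_
    · intro D hD
      have hD' := mem_powersetCard.1 (mem_coe.1 hD)
      have hDx : ∀ x ∈ D, j < x ∧ x ≤ n ∧ x ∉ B := fun x hx => by
        have := hD'.1 hx
        rw [mem_sdiff, mem_Icc] at this
        exact ⟨this.1.1, this.1.2, this.2⟩
      have hdisj : Disjoint B D := disjoint_right.2 fun x hx => (hDx x hx).2.2
      rw [mem_coe, mem_bipartiteAbove, mem_filter, mem_block, card_union_of_disjoint hdisj,
        hB'.1.2, hD'.2]
      refine ⟨⟨⟨⟨union_subset hB'.1.1 fun x hx => ?_, by omega⟩, ?_⟩, B, hB, subset_union_left⟩,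
        subset_union_left⟩
      · have := hDx x hx
        rw [mem_Icc]
        omega
      · ext x
        have h₂ := hBj x
        have h₃ := hw' x
        have h₄ := hDx x
        grind
    · intro D hD D' hD' h
      have hD' := (mem_powersetCard.1 (mem_coe.1 hD')).1
      have hD := (mem_powersetCard.1 (mem_coe.1 hD)).1
      have h : B ∪ D = B ∪ D' := h
      ext x
      have h₁ : x ∈ B ∪ D ↔ x ∈ B ∪ D' := by rw [h]
      have h₂ := @hD x
      have h₃ := @hD' x
      grind
  · intro c hc
    have hc' := mem_block.1 (mem_filter.1 hc).1
    have hwc : w ⊆ c := hc'.2 ▸ inter_subset_left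
    rw [← hc'.1.2, ← card_sdiff_of_subset hwc, ← card_powersetCard]
    refine card_le_card_of_injOn (fun B => B \ w) ?_ ?_
    · intro B hB
      rw [mem_coe, mem_bipartiteBelow] at hB
      have hB' := mem_block.1 (hℱ hB.1)
      have hwB : w ⊆ B := hB'.2 ▸ inter_subset_left
      rw [mem_coe, mem_powersetCard, card_sdiff_of_subset hwB, hB'.1.2]
      exact ⟨sdiff_subset_sdiff hB.2 subset_rfl, rfl⟩
    · intro B hB B' hB' h
      rw [mem_coe, mem_bipartiteBelow] at hB hB'
      have h₁ : w ⊆ B := (mem_block.1 (hℱ hB.1)).2 ▸ inter_subset_left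
      have h₂ : w ⊆ B' := (mem_block.1 (hℱ hB'.1)).2 ▸ inter_subset_left
      rw [← sdiff_union_of_subset h₁, ← sdiff_union_of_subset h₂]
      exact congrArg (· ∪ w) h

/-- If c first differs from K at i, then i together with the part of K below i extends inside c to a
k-set preceding K, unless K ⊆ c already. -/
theorem lexFam_subset_upperSets {n k : ℕ} {K : Finset ℕ} (hn : 2 * k < n) (hK : K ⊆ Icc 2 n)
    (hKk : #K = k) : lexFam n K (n - k) ⊆ upperSets n (n - k) (lexFam n K k) := by
  intro c hc
  rw [mem_lexFam hK] at hc
  refine mem_upperSets.2 ⟨hc.1, ?_⟩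
  have hself : K ∈ lexFam n K k := (mem_lexFam hK).2 ⟨⟨hK, hKk⟩, LexLE.refl _⟩
  rcases lexLE_iff.1 hc.2 with rfl | ⟨i, hic, hiK, hag⟩
  · exact ⟨_, hself, subset_rfl⟩
  by_cases hKi : ∀ x ∈ K, x < i
  · exact ⟨K, hself, fun x hx => (hag x (hKi x hx)).2 hx⟩
  push Not at hKi
  obtain ⟨y, hyK, hy⟩ := hKi
  have h₁ : insert i (K.filter (· < i)) ⊆ c := by
    refine insert_subset hic fun x hx => ?_
    rw [mem_filter] at hx
    exact (hag x hx.2).2 hx.1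
  have h₂ : #(insert i (K.filter (· < i))) ≤ k := by
    rw [card_insert_of_notMem (by simp), ← hKk, Nat.succ_le_iff]
    exact card_lt_card (filter_ssubset.2 ⟨y, hyK, not_lt.2 hy⟩)
  obtain ⟨B, hB, hBc, hBk⟩ := exists_subsuperset_card_eq h₁ h₂ (by omega)
  refine ⟨B, (mem_lexFam hK).2 ⟨⟨hBc.trans hc.1.1, hBk⟩, Or.inr ⟨i, ?_, fun z hz => ?_⟩⟩, hBc⟩
  · exact mem_sdiff.2 ⟨hB (mem_insert_self _ _), hiK⟩
  · rw [mem_sdiff] at hz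
    by_contra hlt
    rcases eq_or_lt_of_le (not_lt.1 hlt) with rfl | hlt
    · exact hiK hz.1
    · exact hz.2 (hB (mem_insert_of_mem (mem_filter.2 ⟨hz.1, hlt⟩)))

/-- If the walk of `K` has height zero at `j`, the families preceding `K` have excess over their
upper shadows at most the gain of the prefix. -/
theorem card_lexFam_sub_card_upperSets_le {n k j : ℕ} {K : Finset ℕ} (hn : 2 * k < n)
    (hK : K ⊆ Icc 2 n) (hKk : #K = k) (hj : 1 ≤ j) (hjn : j ≤ n)
    (hjw : j = 2 * #(K ∩ Icc 2 j)) :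
    (#(lexFam n K k) : ℤ) - #(upperSets n (n - k) (lexFam n K k)) ≤ gain n k (K ∩ Icc 2 j) := by
  set w := K ∩ Icc 2 j with hw
  set ℒ := lexFam n K k with hℒ
  have hwj : w ⊆ Icc 2 j := inter_subset_right
  have hwn : w ⊆ Icc 2 n := hwj.trans (Icc_subset_Icc_right hjn)
  have hwk : #w ≤ k := hKk ▸ card_le_card inter_subset_left
  have hKw : LexLE K w := Or.inl inter_subset_left
  have hblock : ∀ a, block n a j w ⊆ lexFam n w a := fun a A hA => by
    rw [mem_block] at hA
    rw [mem_lexFam hwn]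
    exact ⟨hA.1, Or.inl (hA.2 ▸ inter_subset_left)⟩
  have h₁ := card_le_card_block_upperSets hn hj hjn hwj hwk hjw
    (filter_subset (fun B => B ∈ ℒ) (block n k j w))
  have h₂ : #ℒ + #(block n k j w) ≤
      #(lexFam n w k) + #((block n k j w).filter fun B => B ∈ ℒ) := by
    rw [← card_sdiff_add_card_eq_card (hblock k), add_right_comm]
    refine Nat.add_le_add_right ((card_le_card ?_).trans (card_union_le _ _)) _
    intro A hA
    have hA' := (mem_lexFam hK).1 hA
    have hAw : A ∈ lexFam n w k := (mem_lexFam hwn).2 ⟨hA'.1, hA'.2.trans hKw⟩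
    by_cases hb : A ∈ block n k j w
    · exact mem_union_right _ (mem_filter.2 ⟨hb, hA⟩)
    · exact mem_union_left _ (mem_sdiff.2 ⟨hAw, hb⟩)
  -- An (n-k)-set preceding w outside the block differs from w by time j, hence precedes K and lies
  -- in the upper shadow. Inside the block the double count applies.
  have h₃ : #(lexFam n w (n - k)) + #((block n (n - k) j w).filter fun c =>
      ∃ B ∈ (block n k j w).filter fun B => B ∈ ℒ, B ⊆ c) ≤
      #(upperSets n (n - k) ℒ) + #(block n (n - k) j w) := by
    rw [← card_sdiff_add_card_eq_card (hblock (n - k)), add_right_comm]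
    refine Nat.add_le_add_right ?_ _
    rw [← card_union_of_disjoint]
    · refine card_le_card (union_subset (fun c hc => ?_) fun c hc => ?_)
      · rw [mem_sdiff, mem_lexFam hwn] at hc
        refine lexFam_subset_upperSets hn hK hKk ((mem_lexFam hK).2 ⟨hc.1.1, ?_⟩)
        have hne : c ∩ Icc 2 j ≠ w := fun h => hc.2 (mem_block.2 ⟨hc.1.1, h⟩)
        rcases lexLE_iff.1 hc.1.2 with rfl | ⟨i, hic, hiw, hag⟩
        · exact absurd (inter_eq_left.2 hwj) hne
        have hc2 : ∀ x ∈ c, 2 ≤ x := fun x hx => (mem_Icc.1 (hc.1.1.1 hx)).1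
        have hK2 : ∀ x ∈ K, 2 ≤ x := fun x hx => (mem_Icc.1 (hK hx)).1
        have hij : i ≤ j := by
          by_contra hij
          refine hne ?_
          ext x
          have := hag x
          have := @hwj x
          grind
        refine lexLE_iff.2 (Or.inr ⟨i, hic, ?_, fun y hy => ?_⟩)
        · have := hc2 i hic
          grind
        · have := hag y hy
          have := hK2 y
          grind
      · rw [mem_filter, mem_block] at hc
        obtain ⟨hc, B, hB, hBc⟩ := hc
        exact mem_upperSets.2 ⟨hc.1, B, (mem_filter.1 hB).2, hBc⟩
    · rw [disjoint_left]
      intro c hc hc'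
      exact (mem_sdiff.1 hc).2 (mem_filter.1 hc').1
  have h₄ := blockGain_eq_zero hn hj hjn hwj hwk hjw
  rw [blockGain] at h₄
  rw [gain]
  omega

theorem CrossIntersecting.card_add_card_upperSets_le {n k : ℕ} (hk : 1 ≤ k) (hn : 2 * k < n)
    {𝒜 ℬ : Finset (Finset ℕ)} (h𝒜 : 𝒜 ⊆ (Icc 2 n).powersetCard (k - 1))
    (h : CrossIntersecting 𝒜 ℬ) :
    #𝒜 + #(upperSets n (n - k) ℬ) ≤ (n - 1).choose (k - 1) := by
  have hcard : #(Icc 2 n) = n - 1 := by simp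
  have himg : #((upperSets n (n - k) ℬ).image fun c => Icc 2 n \ c) =
      #(upperSets n (n - k) ℬ) := by
    refine card_image_of_injOn fun c hc d hd hcd => ?_
    rw [mem_coe, mem_upperSets] at hc hd
    rw [← Finset.sdiff_sdiff_eq_self hc.1.1, ← Finset.sdiff_sdiff_eq_self hd.1.1]
    exact congrArg (Icc 2 n \ ·) hcd
  rw [← himg, ← hcard, ← card_powersetCard, ← card_union_of_disjoint]
  · refine card_le_card (union_subset h𝒜 fun A hA => ?_)
    obtain ⟨c, hc, rfl⟩ := mem_image.1 hA
    rw [mem_upperSets] at hc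
    rw [mem_powersetCard, card_sdiff_of_subset hc.1.1, hc.1.2, hcard]
    exact ⟨sdiff_subset, by omega⟩
  · rw [disjoint_left]
    intro A hA hA'
    obtain ⟨c, hc, rfl⟩ := mem_image.1 hA'
    obtain ⟨-, B, hB, hBc⟩ := mem_upperSets.1 hc
    obtain ⟨x, hx⟩ := h _ hA B hB
    rw [mem_inter, mem_sdiff] at hx
    exact hx.1.2 (hBc hx.2)

/-- The height is 2 at time 4, at most 0 at time 2k, and changes by 1 per step; so the first
nonpositive height is 0, reached by a down-step. -/
theorem exists_first_zero {n k : ℕ} {K : Finset ℕ} (hk : 3 ≤ k) (hn : 2 * k < n) (hKk : #K = k)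
    (hK : {2, 3, 4} ⊆ K) :
    ∃ j, 4 ≤ j ∧ j + 1 ≤ n ∧ PositiveWalk j K ∧ j + 1 ∉ K ∧
      j + 1 = 2 * #(K ∩ Icc 2 (j + 1)) := by
  classical
  have hex : ∃ j, 4 ≤ j ∧ 2 * #(K ∩ Icc 2 j) ≤ j :=
    ⟨2 * k, by omega, by have := card_le_card (inter_subset_left : K ∩ Icc 2 (2 * k) ⊆ K); omega⟩
  have hle : Nat.find hex ≤ 2 * k := Nat.find_min' hex
    ⟨by omega, by have := card_le_card (inter_subset_left : K ∩ Icc 2 (2 * k) ⊆ K); omega⟩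
  have hspec := Nat.find_spec hex
  have hmin := fun i => Nat.find_min hex (m := i)
  set j := Nat.find hex
  have h4 : K ∩ Icc 2 4 = {2, 3, 4} := by
    ext x
    have := @hK x
    grind
  have hj5 : j ≠ 4 := by
    intro h
    rw [h, h4] at hspec
    revert hspec
    decide
  obtain ⟨i, hi⟩ : ∃ i, j = i + 1 := ⟨j - 1, by omega⟩
  rw [hi] at hspec hmin hle hj5
  have hpos : PositiveWalk i K := fun l hl hli => by
    have := hmin l (by omega)
    omega
  have hlast := hpos i (by omega) le_rfl
  have hmono : #(K ∩ Icc 2 i) ≤ #(K ∩ Icc 2 (i + 1)) :=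
    card_le_card (inter_subset_inter_left (Icc_subset_Icc_right (by omega)))
  refine ⟨i, by omega, by omega, hpos, fun hiK => ?_, by omega⟩
  have := card_inter_Icc_succ_of_mem (by omega) hiK
  omega

/-- Every pair of cross-intersecting families with small second member is dominated by the pair
of some resistant set. -/
theorem CrossIntersecting.exists_isResistantSet {n k j : ℕ} (hk : 3 ≤ k) (hn : 2 * k < n)
    {𝒜 ℬ : Finset (Finset ℕ)} (h𝒜 : 𝒜 ⊆ (Icc 2 n).powersetCard (k - 1))
    (hℬ : ℬ ⊆ (Icc 2 n).powersetCard k) (h : CrossIntersecting 𝒜 ℬ) (hpos : 1 ≤ #ℬ)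
    {T : Finset ℕ} (hT : IsResistantSet n k j T) (hle : #ℬ ≤ #(lexFam n T k)) :
    ∃ j' T', IsResistantSet n k j' T' ∧ #ℬ ≤ #(lexFam n T' k) ∧
      ((#𝒜 + #ℬ : ℕ) : ℤ) ≤ (n - 1).choose (k - 1) + gain n k T' := by
  obtain ⟨K, hK, hKk, hKcard⟩ := exists_card_lexFam_eq hpos (card_le_card hℬ)
  have hKT : LexLE K T := by
    by_contra hc
    have hTK := (LexLE.total K T).resolve_left hc
    have hss : lexFam n T k ⊂ lexFam n K k := by
      refine (ssubset_iff_of_subset fun A hA => ?_).2 ⟨K, ?_, fun hK' => ?_⟩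
      · rw [mem_lexFam hT.subset_Icc] at hA
        exact (mem_lexFam hK).2 ⟨hA.1, hA.2.trans hTK⟩
      · exact (mem_lexFam hK).2 ⟨⟨hK, hKk⟩, LexLE.refl _⟩
      · exact hc ((mem_lexFam hT.subset_Icc).1 hK').2
    have := card_lt_card hss
    omega
  have hTbase : ({2, 3, 4} : Finset ℕ) ⊆ T := hT.base ▸ inter_subset_left
  have hKbase : {2, 3, 4} ⊆ K := by
    rcases hKT with h' | ⟨x, hx, hx'⟩
    · exact hTbase.trans h'
    · have hx2 := mem_Icc.1 (hK (mem_sdiff.1 hx).1)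
      intro y hy
      by_contra hyK
      have := hx' y (mem_sdiff.2 ⟨hTbase hy, hyK⟩)
      have hxT : x ∉ ({2, 3, 4} : Finset ℕ) := fun h' => (mem_sdiff.1 hx).2 (hTbase h')
      grind
  obtain ⟨i, hi4, hin, hwalk, hiK, hzero⟩ := exists_first_zero hk hn hKk hKbase
  have h₁ := card_lexFam_sub_card_upperSets_le hn hK hKk (by omega) hin hzero
  rw [inter_Icc_succ_of_notMem hiK] at h₁
  obtain ⟨j', T', hT', hle', hgain⟩ := hwalk.exists_isResistantSet hk hn hi4 (by omega)
    (hKk ▸ card_le_card inter_subset_left)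
  have h₂ := card_upperSets_lexFam_le (by omega) hn hK hKk hℬ hKcard.le
  have h₃ := h.card_add_card_upperSets_le (by omega) hn h𝒜
  refine ⟨j', T', hT', ?_, by omega⟩
  rw [← hKcard]
  refine card_le_card fun A hA => ?_
  rw [mem_lexFam hK] at hA
  exact (mem_lexFam hT'.subset_Icc).2
    ⟨hA.1, (hA.2.trans (Or.inl inter_subset_left)).trans hle'⟩

/-! ### The enumeration and intersecting families -/

theorem IsResistantEnumeration.card_lt {n k m : ℕ} {S T : ℕ → Finset ℕ} (hk : 3 ≤ k)
    (hn : 2 * k < n) (hST : IsResistantEnumeration n k m S T) {l l' : ℕ} (hl : l < l')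
    (hlm : l' ≤ m) :
    #(lexFam n (S l') (k - 1)) + #(lexFam n (T l') k) <
      #(lexFam n (S l) (k - 1)) + #(lexFam n (T l) k) := by
  obtain ⟨j', hT', hS'⟩ := (hST.resistant l' (by omega) hlm).exists_isResistantSet hk hn
  have h' := hT'.card_add_card (by omega) hn hS'
  -- Index 0 contributes C(n-1,k-1), as if its gain were 0; every resistant set has negative gain.
  rcases Nat.eq_zero_or_pos l with rfl | hl0
  · rw [hST.S_zero, hST.T_zero, lexFam_top hk hn, card_lexFam_pair hk hn, card_empty]
    have := hT'.gain_neg hn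
    omega
  · obtain ⟨j, hT, hS⟩ := (hST.resistant l hl0 (by omega)).exists_isResistantSet hk hn
    have h := hT.card_add_card (by omega) hn hS
    have := hT.gain_lt_gain hn hT' (hST.increasing l l' hl hlm)
    omega

theorem IsResistantEnumeration.card_add_card_le {n k m : ℕ} {S T : ℕ → Finset ℕ} (hk : 3 ≤ k)
    (hn : 2 * k < n) (hST : IsResistantEnumeration n k m S T) {l : ℕ} (hl : 1 ≤ l)
    (hlm : l ≤ m) {𝒜 ℬ : Finset (Finset ℕ)} (h𝒜 : 𝒜 ⊆ (Icc 2 n).powersetCard (k - 1))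
    (hℬ : ℬ ⊆ (Icc 2 n).powersetCard k) (h : CrossIntersecting 𝒜 ℬ)
    (hlt : #(lexFam n (T (l - 1)) k) < #ℬ) (hle : #ℬ ≤ #(lexFam n (T l) k)) :
    #𝒜 + #ℬ ≤ #(lexFam n (S l) (k - 1)) + #(lexFam n (T l) k) := by
  obtain ⟨j, hT, -⟩ := (hST.resistant l hl hlm).exists_isResistantSet hk hn
  obtain ⟨j', T', hT', hle', hgain⟩ := h.exists_isResistantSet hk hn h𝒜 hℬ (by omega) hT hle
  obtain ⟨S', hST'⟩ := hT'.exists_isResistantPair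
  obtain ⟨l', hl', hlm', rfl, rfl⟩ := hST.exhaustive S' T' hST'
  obtain ⟨j'', hT'', hS''⟩ := hST'.exists_isResistantSet hk hn
  rw [← hT''.card_add_card (by omega) hn hS'', Nat.cast_le] at hgain
  rcases lt_trichotomy l l' with hll | rfl | hll
  · exact hgain.trans (hST.card_lt hk hn hll hlm').le
  · exact hgain
  -- An index below l would force |ℬ| ≤ |ℒ(T_{l-1},k)|, contradicting `hlt`.
  · have hmono : LexLE (T l') (T (l - 1)) := by
      rcases eq_or_lt_of_le (by omega : l' ≤ l - 1) with heq | hlt'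
      · rw [heq]
        exact LexLE.refl _
      · exact (hST.increasing l' (l - 1) hlt' (by omega)).1
    obtain ⟨i, hTi, -⟩ := (hST.resistant (l - 1) (by omega) (by omega)).exists_isResistantSet hk hn
    have := card_le_card (fun A hA => by
      rw [mem_lexFam hT'.subset_Icc] at hA
      exact (mem_lexFam hTi.subset_Icc).2 ⟨hA.1, hA.2.trans hmono⟩ :
      lexFam n (T l') k ⊆ lexFam n (T (l - 1)) k)
    omega

theorem exists_maxDeg_eq {n : ℕ} (hn : 1 ≤ n) (ℱ : Finset (Finset ℕ)) :
    ∃ i ∈ Icc 1 n, maxDeg n ℱ = #(ℱ.filter fun F => i ∈ F) :=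
  exists_mem_eq_sup _ ⟨1, by simpa using hn⟩ _

/-- After renaming an element of maximal degree to `1`, the members through `1` (with `1` deleted)
and the members avoiding `1` are cross-intersecting. -/
theorem exists_crossIntersecting {n k : ℕ} (hn : 1 ≤ n)
    {ℱ : Finset (Finset ℕ)} (hℱ : ℱ ⊆ (Icc 1 n).powersetCard k)
    (hint : (ℱ : Set (Finset ℕ)).Intersecting) :
    ∃ 𝒜 ℬ : Finset (Finset ℕ), 𝒜 ⊆ (Icc 2 n).powersetCard (k - 1) ∧
      ℬ ⊆ (Icc 2 n).powersetCard k ∧ CrossIntersecting 𝒜 ℬ ∧ #ℬ = diversity n ℱ ∧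
      #𝒜 + #ℬ = #ℱ := by
  obtain ⟨i, hi, hdeg⟩ := exists_maxDeg_eq hn ℱ
  rw [mem_Icc] at hi
  set σ : Equiv.Perm ℕ := Equiv.swap 1 i with hσ
  have hσinj : Function.Injective fun F : Finset ℕ => F.map σ.toEmbedding :=
    map_injective _
  have hσ1 : ∀ F : Finset ℕ, 1 ∈ F.map σ.toEmbedding ↔ i ∈ F := fun F => by
    rw [mem_map_equiv, hσ, Equiv.symm_swap, Equiv.swap_apply_left]
  have hσn : ∀ F ∈ ℱ, ∀ x ∈ F.map σ.toEmbedding, 1 ≤ x ∧ x ≤ n := by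
    intro F hF x hx
    rw [mem_map_equiv, hσ, Equiv.symm_swap] at hx
    have hx' := mem_Icc.1 ((mem_powersetCard.1 (hℱ hF)).1 hx)
    rw [Equiv.swap_apply_def] at hx'
    split_ifs at hx' <;> omega
  have hcardF : ∀ F ∈ ℱ, #F = k := fun F hF => (mem_powersetCard.1 (hℱ hF)).2
  have hsum := card_filter_add_card_filter_not (s := ℱ) (fun F => i ∈ F)
  refine ⟨(ℱ.filter fun F => i ∈ F).image fun F => (F.map σ.toEmbedding).erase 1,
    (ℱ.filter fun F => i ∉ F).image fun F => F.map σ.toEmbedding, ?_, ?_, ?_, ?_, ?_⟩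
  · intro A hA
    obtain ⟨F, hF, rfl⟩ := mem_image.1 hA
    rw [mem_filter] at hF
    rw [mem_powersetCard, card_erase_of_mem ((hσ1 F).2 hF.2), card_map, hcardF F hF.1]
    refine ⟨fun x hx => ?_, rfl⟩
    rw [mem_erase] at hx
    have := hσn F hF.1 x hx.2
    rw [mem_Icc]
    omega
  · intro B hB
    obtain ⟨F, hF, rfl⟩ := mem_image.1 hB
    rw [mem_filter] at hF
    rw [mem_powersetCard, card_map, hcardF F hF.1]
    refine ⟨fun x hx => ?_, rfl⟩
    have h₁ := hσn F hF.1 x hx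
    have h₂ : x ≠ 1 := fun h => hF.2 ((hσ1 F).1 (h ▸ hx))
    rw [mem_Icc]
    omega
  · intro A hA B hB
    obtain ⟨F, hF, rfl⟩ := mem_image.1 hA
    obtain ⟨G, hG, rfl⟩ := mem_image.1 hB
    rw [mem_filter] at hF hG
    have hFG := hint (mem_coe.2 hF.1) (mem_coe.2 hG.1)
    obtain ⟨x, hxF, hxG⟩ := not_disjoint_iff.1 hFG
    refine ⟨σ x, mem_inter.2 ⟨mem_erase.2 ⟨fun h => ?_, mem_map_of_mem _ hxF⟩,
      mem_map_of_mem _ hxG⟩⟩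
    exact hG.2 ((hσ1 G).1 (h ▸ mem_map_of_mem σ.toEmbedding hxG))
  · rw [card_image_of_injective _ hσinj, diversity, hdeg]
    omega
  · rw [card_image_of_injective _ hσinj, card_image_of_injOn]
    · exact hsum
    · intro F hF G hG h
      have hF := (hσ1 F).2 (mem_filter.1 (mem_coe.1 hF)).2
      have hG := (hσ1 G).2 (mem_filter.1 (mem_coe.1 hG)).2
      refine hσinj ?_
      change F.map σ.toEmbedding = G.map σ.toEmbedding
      rw [← insert_erase hF, ← insert_erase hG]
      exact congrArg (insert 1) h

end

theorem mainTheorem2 (n k : ℕ) (hk : 3 ≤ k) (hn : 2 * k < n)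
    (m : ℕ) (S T : ℕ → Finset ℕ) (hST : IsResistantEnumeration n k m S T) :
    (∀ l : ℕ, 1 ≤ l → l ≤ m →
      (lexFam n (S l) (k - 1)).card + (lexFam n (T l) k).card <
        (lexFam n (S (l - 1)) (k - 1)).card + (lexFam n (T (l - 1)) k).card) ∧
    (∀ l : ℕ, 1 ≤ l → l ≤ m → ∀ 𝒜 ℬ : Finset (Finset ℕ),
      𝒜 ⊆ (Finset.Icc 2 n).powersetCard (k - 1) →
      ℬ ⊆ (Finset.Icc 2 n).powersetCard k →
      CrossIntersecting 𝒜 ℬ →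
      (lexFam n (T (l - 1)) k).card < ℬ.card →
      ℬ.card ≤ (lexFam n (T l) k).card →
      𝒜.card + ℬ.card ≤ (lexFam n (S l) (k - 1)).card + (lexFam n (T l) k).card) ∧
    (∀ l : ℕ, 1 ≤ l → l ≤ m → ∀ ℱ : Finset (Finset ℕ),
      ℱ ⊆ (Finset.Icc 1 n).powersetCard k →
      (ℱ : Set (Finset ℕ)).Intersecting →
      (lexFam n (T (l - 1)) k).card < diversity n ℱ →
      diversity n ℱ ≤ (lexFam n (T l) k).card →
      ℱ.card ≤ (lexFam n (S l) (k - 1)).card + (lexFam n (T l) k).card) := by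
  refine ⟨fun l hl hlm => hST.card_lt hk hn (by omega) hlm,
    fun l hl hlm 𝒜 ℬ h𝒜 hℬ h hlt hle => hST.card_add_card_le hk hn hl hlm h𝒜 hℬ h hlt hle,
    fun l hl hlm ℱ hℱ hint hlt hle => ?_⟩
  obtain ⟨𝒜, ℬ, h𝒜, hℬ, h, hdiv, hcard⟩ :=
    exists_crossIntersecting (by omega) hℱ hint
  rw [← hdiv] at hlt hle
  rw [← hcard]
  exact hST.card_add_card_le hk hn hl hlm h𝒜 hℬ h hlt hle
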